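/- Let $0<r_1<r_2<\infty$ and $s=\sqrt{r_1r_2}$. Given a function $\psi:\{r_1,r_2\}\times\mathbb R\to\mathbb R$ that is continuous and $2\pi$-periodic in the second variable, a solution of the Dirichlet problem with data $\psi$ is a function $u\in C^2((r_1,r_2)\times\mathbb R)\cap C^0([r_1,r_2]\times\mathbb R)$, $2\pi$-periodic in the second variable, with $$u_{rr}+\tfrac1r u_r+\tfrac1{r^2}u_{\theta\theta}=0\ \text{ in }(r_1,r_2)\times\mathbb R,\qquad u=\psi\ \text{ on }\{r_1,r_2\}\times\mathbb R,$$ and a solution of the Neumann problem with data $\psi$ is a function $U\in C^2((r_1,r_2)\times\mathbb R)\cap C^1([r_1,r_2]\times\mathbb R)$, $2\pi$-periodic in the second variable, with $$U_{rr}+\tfrac1r U_r+\tfrac1{r^2}U_{\theta\theta}=0\ \text{ in }(r_1,r_2)\times\mathbb R,\qquad U_r=\psi\ \text{ on }\{r_1,r_2\}\times\mathbb R$$ (at $r=r_1$ and $r=r_2$ the derivative $U_r$ is one-sided). 1. Let $\phi:\{r_1,r_2\}\times\mathbb R\to\mathbb R$ be continuous, $2\pi$-periodic in the second variable, with $\int_0^{2\pi}r_1\phi(r_1,\theta)\,d\theta=\int_0^{2\pi}r_2\phi(r_2,\theta)\,d\theta$,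 and let $U$ be a solution of the Neumann problem with data $\phi$ such that $U(s,0)=0$. Then the Dirichlet problem with data $\varphi(r,\theta)=r\phi(r,\theta)$ has a unique solution $u$ on $[r_1,r_2]\times\mathbb R$, and for all $(r,\theta)\in[r_1,r_2]\times\mathbb R$ $$U(r,\theta)=\int_{s/r}^{1}\frac{u(r\rho,\theta)}{\rho}\,d\rho+s\int_0^\theta\Big(\mathcal C-\int_0^t u_r(s,\tau)\,d\tau\Big)dt,\qquad \mathcal C=\frac1{2\pi}\int_0^{2\pi}\!\int_0^t u_r(s,\tau)\,d\tau\,dt.$$ 2. Conversely, let $\varphi:\{r_1,r_2\}\times\mathbb R\to\mathbb R$ be continuous, $2\pi$-periodic in the second variable, with $\int_0^{2\pi}\varphi(r_1,\theta)\,d\theta=\int_0^{2\pi}\varphi(r_2,\theta)\,d\theta$, and let $U$ be a solution of the Neumann problem with data $\phi(r,\theta)=\varphi(r,\theta)/r$. Then $u(r,\theta)=rU_r(r,\theta)$, $(r,\theta)\in[r_1,r_2]\times\mathbb R$, is the unique solution of the Dirichlet problem with data $\varphi$. -/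

import Mathlib

open Set MeasureTheory

noncomputable section

namespace AnnulusPolar

/-- Admissible boundary data on `{r₁, r₂} × ℝ`: continuous and `2π`-periodic in the angle.
Only the values `φ r₁ θ` and `φ r₂ θ` are relevant. -/
structure IsBoundaryData (r₁ r₂ : ℝ) (φ : ℝ → ℝ → ℝ) : Prop where
  continuousOn : ContinuousOn (Function.uncurry φ) (({r₁, r₂} : Set ℝ) ×ˢ (univ : Set ℝ))
  periodic : ∀ r ∈ ({r₁, r₂} : Set ℝ), ∀ θ : ℝ, φ r (θ + 2 * Real.pi) = φ r θ

/-- The Laplace operator in polar coordinates, `u_rr + (1/r) u_r + (1/r²) u_θθ`. -/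
def polarLaplacian (u : ℝ → ℝ → ℝ) (r θ : ℝ) : ℝ :=
  deriv (deriv fun s => u s θ) r + 1 / r * deriv (fun s => u s θ) r
    + 1 / r ^ 2 * deriv (deriv fun t => u r t) θ

/-- The radial derivative on the closed interval `[r₁, r₂]`; it is the usual partial derivative
`U_r` for `r₁ < r < r₂` and the one-sided one for `r = r₁` and `r = r₂`. -/
def radialDeriv (r₁ r₂ : ℝ) (U : ℝ → ℝ → ℝ) (r θ : ℝ) : ℝ :=
  derivWithin (fun s => U s θ) (Icc r₁ r₂) r

/-- `u ∈ C²((r₁, r₂) × ℝ) ∩ C⁰([r₁, r₂] × ℝ)` is `2π`-periodic in the angle, satisfies the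
Laplace equation in polar coordinates, and equals `φ` on `{r₁, r₂} × ℝ`. -/
structure IsDirichletSolution (r₁ r₂ : ℝ) (φ u : ℝ → ℝ → ℝ) : Prop where
  contDiffOn : ContDiffOn ℝ 2 (Function.uncurry u) (Ioo r₁ r₂ ×ˢ (univ : Set ℝ))
  continuousOn : ContinuousOn (Function.uncurry u) (Icc r₁ r₂ ×ˢ (univ : Set ℝ))
  periodic : ∀ r ∈ Icc r₁ r₂, ∀ θ : ℝ, u r (θ + 2 * Real.pi) = u r θ
  laplace : ∀ r ∈ Ioo r₁ r₂, ∀ θ : ℝ, polarLaplacian u r θ = 0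
  boundary : ∀ r ∈ ({r₁, r₂} : Set ℝ), ∀ θ : ℝ, u r θ = φ r θ

/-- `U ∈ C²((r₁, r₂) × ℝ) ∩ C¹([r₁, r₂] × ℝ)` is `2π`-periodic in the angle, satisfies the
Laplace equation in polar coordinates, and `U_r = φ` on `{r₁, r₂} × ℝ`. -/
structure IsNeumannSolution (r₁ r₂ : ℝ) (φ U : ℝ → ℝ → ℝ) : Prop where
  contDiffOn : ContDiffOn ℝ 2 (Function.uncurry U) (Ioo r₁ r₂ ×ˢ (univ : Set ℝ))
  contDiffOn_closed : ContDiffOn ℝ 1 (Function.uncurry U) (Icc r₁ r₂ ×ˢ (univ : Set ℝ))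
  periodic : ∀ r ∈ Icc r₁ r₂, ∀ θ : ℝ, U r (θ + 2 * Real.pi) = U r θ
  laplace : ∀ r ∈ Ioo r₁ r₂, ∀ θ : ℝ, polarLaplacian U r θ = 0
  boundary : ∀ r ∈ ({r₁, r₂} : Set ℝ), ∀ θ : ℝ, radialDeriv r₁ r₂ U r θ = φ r θ

/-- The constant `𝒞 = (1 / 2π) ∫₀^{2π} ∫₀^t u_r(R, τ) dτ dt` for the circle of radius `R`. -/
def circleConst (R : ℝ) (u : ℝ → ℝ → ℝ) : ℝ :=
  1 / (2 * Real.pi) *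
    ∫ t in (0 : ℝ)..(2 * Real.pi), ∫ τ in (0 : ℝ)..t, deriv (fun s => u s τ) R

end AnnulusPolar

end

namespace AnnulusPolar

open InnerProductSpace Topology Filter

/-! ### Slices and linearity of the polar Laplacian -/

/-! In the variable `z = log r + iθ` the polar Laplacian is `r⁻²` times the flat one, and `r ∂_r`
becomes `∂_x`. Hence `r U_r` is a partial derivative of a harmonic function and so harmonic itself;
being continuous up to the boundary, it solves the Dirichlet problem
(`IsNeumannSolution.isDirichletSolution`). This also gives existence in part 1. Uniqueness is the
weak maximum principle (`nonpos_of_polarLaplacian_eq_zero`).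

For the representation (`IsNeumannSolution.eq_integral`), put `u = r U_r`. The radial integral of `u
/ r` is `U(r,θ) - U(s,θ)`. The Laplace equation gives `u_r = -U_θθ / r`, so two integrations along
the circle `r = s` recover `U(s,θ) - U(s,0)`; periodicity identifies `𝒞` as `U_θ(s,0) / s`. -/

lemma contDiffAt_radial_slice {r₁ r₂ : ℝ} {u : ℝ → ℝ → ℝ} {n : WithTop ℕ∞}
    (hu : ContDiffOn ℝ n (Function.uncurry u) (Ioo r₁ r₂ ×ˢ (univ : Set ℝ)))
    {r : ℝ} (hr : r ∈ Ioo r₁ r₂) (θ : ℝ) : ContDiffAt ℝ n (fun s => u s θ) r := by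
  have h : ContDiffAt ℝ n (Function.uncurry u) (r, θ) :=
    hu.contDiffAt ((isOpen_Ioo.prod isOpen_univ).mem_nhds ⟨hr, mem_univ _⟩)
  exact h.comp r (f := fun s => (s, θ)) (by fun_prop)

lemma contDiff_angular_slice {r₁ r₂ : ℝ} {u : ℝ → ℝ → ℝ} {n : WithTop ℕ∞}
    (hu : ContDiffOn ℝ n (Function.uncurry u) (Ioo r₁ r₂ ×ˢ (univ : Set ℝ)))
    {r : ℝ} (hr : r ∈ Ioo r₁ r₂) : ContDiff ℝ n (u r) := by
  rw [contDiff_iff_contDiffAt]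
  intro θ
  have h : ContDiffAt ℝ n (Function.uncurry u) (r, θ) :=
    hu.contDiffAt ((isOpen_Ioo.prod isOpen_univ).mem_nhds ⟨hr, mem_univ _⟩)
  exact h.comp θ (f := fun t => (r, t)) (by fun_prop)

lemma deriv_deriv_eq_iteratedDeriv (f : ℝ → ℝ) : deriv (deriv f) = iteratedDeriv 2 f := by
  rw [iteratedDeriv_succ, iteratedDeriv_one]

lemma polarLaplacian_add {u v : ℝ → ℝ → ℝ} {r θ : ℝ}
    (hu : ContDiffAt ℝ 2 (fun s => u s θ) r) (hv : ContDiffAt ℝ 2 (fun s => v s θ) r)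
    (hu' : ContDiffAt ℝ 2 (u r) θ) (hv' : ContDiffAt ℝ 2 (v r) θ) :
    polarLaplacian (fun r θ => u r θ + v r θ) r θ
      = polarLaplacian u r θ + polarLaplacian v r θ := by
  simp only [polarLaplacian, deriv_deriv_eq_iteratedDeriv]
  rw [iteratedDeriv_fun_add hu hv, iteratedDeriv_fun_add hu' hv',
    deriv_fun_add (hu.differentiableAt two_ne_zero) (hv.differentiableAt two_ne_zero)]
  ring

lemma polarLaplacian_neg (u : ℝ → ℝ → ℝ) (r θ : ℝ) :
    polarLaplacian (fun r θ => -u r θ) r θ = -polarLaplacian u r θ := by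
  simp only [polarLaplacian, deriv_deriv_eq_iteratedDeriv, iteratedDeriv_fun_neg, deriv.fun_neg]
  ring

lemma polarLaplacian_const_mul_sq (ε θ : ℝ) {r : ℝ} (hr : r ≠ 0) :
    polarLaplacian (fun r _ => ε * r ^ 2) r θ = 4 * ε := by
  have h : deriv (fun s : ℝ => ε * s ^ 2) = fun s => 2 * ε * s := by
    ext s
    simp
    ring
  have h' : deriv (fun s : ℝ => 2 * ε * s) r = 2 * ε := by simp
  simp only [polarLaplacian, h, h', deriv_const', mul_zero, add_zero]
  field_simp
  ring

lemma polarLaplacian_congr {r₁ r₂ : ℝ} {u v : ℝ → ℝ → ℝ}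
    (h : ∀ r ∈ Ioo r₁ r₂, ∀ θ, u r θ = v r θ) {r : ℝ} (hr : r ∈ Ioo r₁ r₂) (θ : ℝ) :
    polarLaplacian u r θ = polarLaplacian v r θ := by
  have h₁ : (fun s => u s θ) =ᶠ[𝓝 r] fun s => v s θ := by
    filter_upwards [isOpen_Ioo.mem_nhds hr] with s hs using h s hs θ
  have h₂ : u r = v r := funext (h r hr)
  simp only [polarLaplacian, h₁.deriv.deriv_eq, h₁.deriv_eq, h₂]

/-! ### The maximum principle -/

/-- A positive second derivative would make `x` a local minimum as well, so `f` would be locally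
constant, with second derivative zero. -/
lemma deriv_deriv_nonpos_of_isLocalMax {f : ℝ → ℝ} {x : ℝ} (hf : ContinuousAt f x)
    (h : IsLocalMax f x) : deriv (deriv f) x ≤ 0 := by
  by_contra! hpos
  have hmin := isLocalMin_of_deriv_deriv_pos hpos h.deriv_eq_zero hf
  have hconst : f =ᶠ[𝓝 x] fun _ => f x := by
    filter_upwards [h, hmin] with y h₁ h₂ using le_antisymm h₁ h₂
  have := hconst.deriv.deriv_eq
  simp at this
  linarith

lemma polarLaplacian_nonpos_of_isMax {r₁ r₂ : ℝ} {u : ℝ → ℝ → ℝ}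
    (hu : ContDiffOn ℝ 2 (Function.uncurry u) (Ioo r₁ r₂ ×ˢ (univ : Set ℝ)))
    {r θ : ℝ} (hr : r ∈ Ioo r₁ r₂) (hmax : ∀ s ∈ Icc r₁ r₂, ∀ t, u s t ≤ u r θ) :
    polarLaplacian u r θ ≤ 0 := by
  have h₁ : IsLocalMax (fun s => u s θ) r := by
    filter_upwards [isOpen_Ioo.mem_nhds hr] with s hs using hmax s (Ioo_subset_Icc_self hs) θ
  have h₂ : IsLocalMax (u r) θ :=
    Eventually.of_forall fun t => hmax r (Ioo_subset_Icc_self hr) t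
  have e₁ := deriv_deriv_nonpos_of_isLocalMax (contDiffAt_radial_slice hu hr θ).continuousAt h₁
  have e₂ := deriv_deriv_nonpos_of_isLocalMax
    (contDiff_angular_slice hu hr).continuous.continuousAt h₂
  have e₃ : 1 / r ^ 2 * deriv (deriv (u r)) θ ≤ 0 :=
    mul_nonpos_of_nonneg_of_nonpos (by positivity) e₂
  simp only [polarLaplacian, h₁.deriv_eq_zero]
  linarith

lemma exists_isMax_of_periodic {r₁ r₂ : ℝ} (h : r₁ ≤ r₂) {u : ℝ → ℝ → ℝ}
    (hu : ContinuousOn (Function.uncurry u) (Icc r₁ r₂ ×ˢ (univ : Set ℝ)))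
    (hper : ∀ r ∈ Icc r₁ r₂, ∀ θ : ℝ, u r (θ + 2 * Real.pi) = u r θ) :
    ∃ r ∈ Icc r₁ r₂, ∃ θ, ∀ s ∈ Icc r₁ r₂, ∀ t, u s t ≤ u r θ := by
  obtain ⟨⟨a, b⟩, ⟨ha, -⟩, hmax⟩ :=
    ((isCompact_Icc (a := r₁) (b := r₂)).prod
      (isCompact_Icc (a := (0 : ℝ)) (b := 2 * Real.pi))).exists_isMaxOn
      ⟨(r₁, 0), ⟨le_rfl, h⟩, le_rfl, Real.two_pi_pos.le⟩
      (hu.mono (prod_mono_right (subset_univ _)))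
  refine ⟨a, ha, b, fun s hs t => ?_⟩
  obtain ⟨t', ht', he⟩ := Function.Periodic.exists_mem_Ico₀ (hper s hs) Real.two_pi_pos t
  rw [he]
  exact hmax (a := (s, t')) ⟨hs, Ico_subset_Icc_self ht'⟩

/-- The weak maximum principle. -/
lemma nonpos_of_polarLaplacian_eq_zero {r₁ r₂ : ℝ} (hr₁ : 0 < r₁) {w : ℝ → ℝ → ℝ}
    (hw : ContDiffOn ℝ 2 (Function.uncurry w) (Ioo r₁ r₂ ×ˢ (univ : Set ℝ)))
    (hc : ContinuousOn (Function.uncurry w) (Icc r₁ r₂ ×ˢ (univ : Set ℝ)))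
    (hper : ∀ r ∈ Icc r₁ r₂, ∀ θ : ℝ, w r (θ + 2 * Real.pi) = w r θ)
    (hlap : ∀ r ∈ Ioo r₁ r₂, ∀ θ : ℝ, polarLaplacian w r θ = 0)
    (hbd : ∀ r ∈ ({r₁, r₂} : Set ℝ), ∀ θ : ℝ, w r θ ≤ 0) {r : ℝ} (hr : r ∈ Icc r₁ r₂) (θ : ℝ) :
    w r θ ≤ 0 := by
  by_contra! hpos
  have hr₁₂ : r₁ ≤ r₂ := hr.1.trans hr.2
  have hr₂ : 0 < r₂ := hr₁.trans_le hr₁₂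
  -- Adding `ε r²` makes the Laplacian `4ε > 0`, which rules out an interior maximum. With this `ε`
  -- the added term is at most half of `w r θ`, so the maximum is not on the boundary either.
  set ε := w r θ / (2 * r₂ ^ 2) with hε
  have hε₀ : 0 < ε := by positivity
  have hεr : ε * r₂ ^ 2 = w r θ / 2 := by rw [hε]; field_simp
  have hq : ContDiff ℝ 2 (Function.uncurry fun r (_ : ℝ) => ε * r ^ 2) := by
    unfold Function.uncurry
    fun_prop
  obtain ⟨a, ha, b, hmax⟩ := exists_isMax_of_periodic (u := fun r θ => w r θ + ε * r ^ 2) hr₁₂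
    (hc.fun_add hq.continuous.continuousOn) (fun r hr θ => by simp only [hper r hr θ])
  have hM := hmax r hr θ
  have hεr' : 0 ≤ ε * r ^ 2 := by positivity
  have hεa : ε * a ^ 2 ≤ ε * r₂ ^ 2 := by
    have := hr₁.le.trans ha.1
    have := ha.2
    gcongr
  have hbd' : a ∉ ({r₁, r₂} : Set ℝ) := fun h => by linarith [hbd a h b]
  simp only [mem_insert_iff, mem_singleton_iff, not_or] at hbd'
  have ha' : a ∈ Ioo r₁ r₂ := ⟨ha.1.lt_of_ne' hbd'.1, ha.2.lt_of_ne hbd'.2⟩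
  have h₁ := polarLaplacian_nonpos_of_isMax (u := fun r θ => w r θ + ε * r ^ 2)
    (hw.add hq.contDiffOn) ha' hmax
  rw [polarLaplacian_add (v := fun r _ => ε * r ^ 2) (contDiffAt_radial_slice hw ha' b)
    (by fun_prop) (contDiff_angular_slice hw ha').contDiffAt (by fun_prop), hlap a ha',
    polarLaplacian_const_mul_sq _ _ (hr₁.trans ha'.1).ne'] at h₁
  linarith

lemma IsDirichletSolution.le {r₁ r₂ : ℝ} (hr₁ : 0 < r₁) {φ u v : ℝ → ℝ → ℝ}
    (hu : IsDirichletSolution r₁ r₂ φ u) (hv : IsDirichletSolution r₁ r₂ φ v)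
    {r : ℝ} (hr : r ∈ Icc r₁ r₂) (θ : ℝ) : u r θ ≤ v r θ := by
  have h := nonpos_of_polarLaplacian_eq_zero (w := fun r θ => u r θ + -v r θ) hr₁
    (hu.contDiffOn.add hv.contDiffOn.neg) (hu.continuousOn.add hv.continuousOn.neg)
    (fun r hr θ => by simp only [hu.periodic r hr, hv.periodic r hr])
    (fun r hr θ => by
      rw [polarLaplacian_add (v := fun r θ => -v r θ) (contDiffAt_radial_slice hu.contDiffOn hr θ)
        (contDiffAt_radial_slice hv.contDiffOn hr θ).neg
        (contDiff_angular_slice hu.contDiffOn hr).contDiffAt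
        (contDiff_angular_slice hv.contDiffOn hr).neg.contDiffAt,
        polarLaplacian_neg, hu.laplace r hr, hv.laplace r hr]
      simp)
    (fun r hr θ => by simp [hu.boundary r hr, hv.boundary r hr]) hr θ
  linarith

/-- Solutions of the Dirichlet problem are unique. -/
lemma IsDirichletSolution.unique {r₁ r₂ : ℝ} (hr₁ : 0 < r₁) {φ u v : ℝ → ℝ → ℝ}
    (hu : IsDirichletSolution r₁ r₂ φ u) (hv : IsDirichletSolution r₁ r₂ φ v)
    {r : ℝ} (hr : r ∈ Icc r₁ r₂) (θ : ℝ) : u r θ = v r θ :=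
  le_antisymm (hu.le hr₁ hv hr θ) (hv.le hr₁ hu hr θ)

lemma IsDirichletSolution.congr_data {r₁ r₂ : ℝ} {φ ψ u : ℝ → ℝ → ℝ}
    (hu : IsDirichletSolution r₁ r₂ φ u)
    (h : ∀ r ∈ ({r₁, r₂} : Set ℝ), ∀ θ, φ r θ = ψ r θ) : IsDirichletSolution r₁ r₂ ψ u :=
  { hu with boundary := fun r hr θ => (hu.boundary r hr θ).trans (h r hr θ) }

/-! ### Logarithmic coordinates -/

lemma hasDerivAt_log_mk {r : ℝ} (hr : 0 < r) (θ : ℝ) :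
    HasDerivAt (fun s : ℝ => (⟨Real.log s, θ⟩ : ℂ)) ((r⁻¹ : ℝ) • (1 : ℂ)) r := by
  have h := ((Real.hasDerivAt_log hr.ne').ofReal_comp).add_const ((θ : ℂ) * Complex.I)
  simp only [Complex.mk_eq_add_mul_I]
  convert! h using 1
  simp

lemma hasDerivAt_mk_right (x θ : ℝ) :
    HasDerivAt (fun t : ℝ => (⟨x, t⟩ : ℂ)) Complex.I θ := by
  have h := ((hasDerivAt_id θ).ofReal_comp.mul_const Complex.I).const_add (x : ℂ)
  simp only [Complex.mk_eq_add_mul_I]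
  convert! h using 1
  simp

lemma hasDerivAt_comp_log_mk {G : ℂ → ℝ} {r θ : ℝ} (hr : 0 < r)
    (hG : DifferentiableAt ℝ G ⟨Real.log r, θ⟩) :
    HasDerivAt (fun s : ℝ => G ⟨Real.log s, θ⟩) (r⁻¹ * fderiv ℝ G ⟨Real.log r, θ⟩ 1) r := by
  have h := hG.hasFDerivAt.comp_hasDerivAt r (hasDerivAt_log_mk hr θ)
  rw [map_smul, smul_eq_mul] at h
  exact h

lemma hasDerivAt_comp_mk_right {G : ℂ → ℝ} {x θ : ℝ} (hG : DifferentiableAt ℝ G ⟨x, θ⟩) :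
    HasDerivAt (fun t : ℝ => G ⟨x, t⟩) (fderiv ℝ G ⟨x, θ⟩ Complex.I) θ :=
  hG.hasFDerivAt.comp_hasDerivAt θ (hasDerivAt_mk_right x θ)

/-- Chain rule: the term `-r⁻² G_x` from differentiating `r⁻¹ G_x` cancels the first-order term of
the polar Laplacian. -/
lemma polarLaplacian_comp_log {G : ℂ → ℝ} {r θ : ℝ} (hr : 0 < r)
    (hG : ContDiffAt ℝ 2 G ⟨Real.log r, θ⟩) :
    polarLaplacian (fun r θ => G ⟨Real.log r, θ⟩) r θ = 1 / r ^ 2 * Laplacian.laplacian G ⟨Real.log r, θ⟩ := by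
  have hev : ∀ᶠ z in 𝓝 (⟨Real.log r, θ⟩ : ℂ), DifferentiableAt ℝ G z := by
    filter_upwards [hG.eventually (by simp)] with z hz using hz.differentiableAt two_ne_zero
  have hd : DifferentiableAt ℝ (fderiv ℝ G) ⟨Real.log r, θ⟩ :=
    (hG.fderiv_right (m := 1) (by norm_num)).differentiableAt one_ne_zero
  have hd' (v : ℂ) : DifferentiableAt ℝ (fun z => fderiv ℝ G z v) ⟨Real.log r, θ⟩ := by fun_prop
  have hv (v w : ℂ) : fderiv ℝ (fun z => fderiv ℝ G z v) ⟨Real.log r, θ⟩ w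
      = fderiv ℝ (fderiv ℝ G) ⟨Real.log r, θ⟩ w v := by
    rw [fderiv_clm_apply hd (by fun_prop)]
    simp
  have h₁ : deriv (fun s : ℝ => G ⟨Real.log s, θ⟩)
      =ᶠ[𝓝 r] fun s => s⁻¹ * fderiv ℝ G ⟨Real.log s, θ⟩ 1 := by
    filter_upwards [(hasDerivAt_log_mk hr θ).continuousAt.eventually hev,
      lt_mem_nhds hr] with s hs hs₀ using (hasDerivAt_comp_log_mk hs₀ hs).deriv
  have h₂ : deriv (fun t : ℝ => G ⟨Real.log r, t⟩)
      =ᶠ[𝓝 θ] fun t => fderiv ℝ G ⟨Real.log r, t⟩ Complex.I := by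
    filter_upwards [(hasDerivAt_mk_right (Real.log r) θ).continuousAt.eventually hev] with t ht
      using (hasDerivAt_comp_mk_right ht).deriv
  have h₃ := (hasDerivAt_inv hr.ne').fun_mul (hasDerivAt_comp_log_mk hr (hd' 1))
  have h₄ := hasDerivAt_comp_mk_right (hd' Complex.I)
  rw [hv] at h₃ h₄
  simp only [polarLaplacian, h₁.deriv_eq, h₂.deriv_eq, h₁.self_of_nhds, h₃.deriv, h₄.deriv,
    laplacian_eq_iteratedFDeriv_complexPlane, iteratedFDeriv_two_apply, Matrix.cons_val_zero,
    Matrix.cons_val_one]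
  field_simp
  ring

/-- The function `u` in the complex variable `log r + i θ`. -/
noncomputable def logLift (u : ℝ → ℝ → ℝ) (z : ℂ) : ℝ := u (Real.exp z.re) z.im

lemma logLift_log (u : ℝ → ℝ → ℝ) {r : ℝ} (hr : 0 < r) (θ : ℝ) :
    logLift u ⟨Real.log r, θ⟩ = u r θ := by
  simp [logLift, Real.exp_log hr]

lemma isOpen_re_exp_mem_Ioo (r₁ r₂ : ℝ) : IsOpen {z : ℂ | Real.exp z.re ∈ Ioo r₁ r₂} :=
  isOpen_Ioo.preimage (Real.continuous_exp.comp Complex.continuous_re)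

lemma contDiffAt_logLift {r₁ r₂ : ℝ} {u : ℝ → ℝ → ℝ}
    (hu : ContDiffOn ℝ 2 (Function.uncurry u) (Ioo r₁ r₂ ×ˢ (univ : Set ℝ)))
    {z : ℂ} (hz : Real.exp z.re ∈ Ioo r₁ r₂) : ContDiffAt ℝ 2 (logLift u) z := by
  have h : ContDiffAt ℝ 2 (Function.uncurry u) (Real.exp z.re, z.im) :=
    hu.contDiffAt ((isOpen_Ioo.prod isOpen_univ).mem_nhds ⟨hz, mem_univ _⟩)
  have hre : ContDiffAt ℝ 2 (fun z : ℂ => z.re) z := Complex.reCLM.contDiff.contDiffAt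
  have him : ContDiffAt ℝ 2 (fun z : ℂ => z.im) z := Complex.imCLM.contDiff.contDiffAt
  exact h.comp z (f := fun z : ℂ => (Real.exp z.re, z.im)) (hre.exp.prodMk him)

lemma harmonicAt_logLift {r₁ r₂ : ℝ} (hr₁ : 0 < r₁) {u : ℝ → ℝ → ℝ}
    (hu : ContDiffOn ℝ 2 (Function.uncurry u) (Ioo r₁ r₂ ×ˢ (univ : Set ℝ)))
    (hlap : ∀ r ∈ Ioo r₁ r₂, ∀ θ : ℝ, polarLaplacian u r θ = 0)
    {z : ℂ} (hz : Real.exp z.re ∈ Ioo r₁ r₂) : HarmonicAt (logLift u) z := by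
  refine ⟨contDiffAt_logLift hu hz, ?_⟩
  filter_upwards [(isOpen_re_exp_mem_Ioo r₁ r₂).mem_nhds hz] with y hy
  have hlog : (⟨Real.log (Real.exp y.re), y.im⟩ : ℂ) = y := by simp
  have h := polarLaplacian_comp_log (G := logLift u) (r := Real.exp y.re) (θ := y.im)
    (Real.exp_pos _) (by rw [hlog]; exact contDiffAt_logLift hu hy)
  rw [hlog, ← polarLaplacian_congr (fun s hs θ => (logLift_log u (hr₁.trans hs.1) θ).symm) hy,
    hlap _ hy] at h
  have := Real.exp_pos y.re
  simpa [this.ne'] using h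

/-- `F_x` is the real part of the analytic function `F_x - i F_y`. This supplies the third
derivatives of `U` that `C²` alone does not. -/
lemma harmonicAt_fderiv_one {F : ℂ → ℝ} {z : ℂ} (hF : HarmonicAt F z) :
    HarmonicAt (fun w => fderiv ℝ F w 1) z := by
  have h := (HarmonicAt.analyticAt_complex_partial hF).harmonicAt_re
  simpa using h

/-! ### From the Neumann problem to the Dirichlet problem -/

lemma radialDeriv_eq_deriv {r₁ r₂ r : ℝ} (U : ℝ → ℝ → ℝ) (hr : r ∈ Ioo r₁ r₂) (θ : ℝ) :
    radialDeriv r₁ r₂ U r θ = deriv (fun s => U s θ) r :=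
  derivWithin_of_mem_nhds (Icc_mem_nhds hr.1 hr.2)

lemma mul_radialDeriv_eq {r₁ r₂ r : ℝ} (hr₁ : 0 < r₁) {U : ℝ → ℝ → ℝ}
    (hU : ContDiffOn ℝ 2 (Function.uncurry U) (Ioo r₁ r₂ ×ˢ (univ : Set ℝ)))
    (hr : r ∈ Ioo r₁ r₂) (θ : ℝ) :
    r * radialDeriv r₁ r₂ U r θ = fderiv ℝ (logLift U) ⟨Real.log r, θ⟩ 1 := by
  have hr₀ : 0 < r := hr₁.trans hr.1
  have h := hasDerivAt_comp_log_mk (θ := θ) hr₀ ((contDiffAt_logLift hU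
    (by simpa [Real.exp_log hr₀] using hr)).differentiableAt two_ne_zero)
  have he : (fun s => U s θ) =ᶠ[𝓝 r] fun s => logLift U ⟨Real.log s, θ⟩ := by
    filter_upwards [lt_mem_nhds hr₀] with s hs using (logLift_log U hs θ).symm
  rw [radialDeriv_eq_deriv U hr, he.deriv_eq, h.deriv]
  field_simp

/-- The one-sided derivative is the total derivative within the closed strip applied to `(1, 0)`,
and the former is continuous up to the boundary. -/
lemma continuousOn_radialDeriv {r₁ r₂ : ℝ} (hr₁₂ : r₁ < r₂) {U : ℝ → ℝ → ℝ}
    (hU : ContDiffOn ℝ 1 (Function.uncurry U) (Icc r₁ r₂ ×ˢ (univ : Set ℝ))) :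
    ContinuousOn (Function.uncurry (radialDeriv r₁ r₂ U)) (Icc r₁ r₂ ×ˢ (univ : Set ℝ)) := by
  have hcont := hU.continuousOn_fderivWithin
    ((uniqueDiffOn_Icc hr₁₂).prod uniqueDiffOn_univ) le_rfl
  refine (hcont.clm_apply (continuousOn_const (c := ((1, 0) : ℝ × ℝ)))).congr fun p hp => ?_
  obtain ⟨r, θ⟩ := p
  have hr : r ∈ Icc r₁ r₂ := hp.1
  have hd := ((hU.differentiableOn one_ne_zero) (r, θ) ⟨hr, mem_univ _⟩).hasFDerivWithinAt
  have hline : HasDerivWithinAt (fun s : ℝ => (s, θ)) ((1 : ℝ), (0 : ℝ)) (Icc r₁ r₂) r :=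
    ((hasDerivAt_id r).prodMk (hasDerivAt_const r θ)).hasDerivWithinAt
  have hmaps : MapsTo (fun s : ℝ => (s, θ)) (Icc r₁ r₂) (Icc r₁ r₂ ×ˢ (univ : Set ℝ)) :=
    fun s hs => ⟨hs, mem_univ _⟩
  exact (hd.comp_hasDerivWithinAt r hline hmaps).derivWithin
    (uniqueDiffOn_Icc hr₁₂ r hr)

/-- If `U` solves the Neumann problem with data `φ`, then `r U_r` solves the Dirichlet problem
with data `r φ`. -/
lemma IsNeumannSolution.isDirichletSolution {r₁ r₂ : ℝ} (hr₁ : 0 < r₁) (hr₁₂ : r₁ < r₂)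
    {φ U : ℝ → ℝ → ℝ} (hU : IsNeumannSolution r₁ r₂ φ U) :
    IsDirichletSolution r₁ r₂ (fun r θ => r * φ r θ)
      (fun r θ => r * radialDeriv r₁ r₂ U r θ) := by
  have hharm {r : ℝ} (hr : r ∈ Ioo r₁ r₂) (θ : ℝ) :
      HarmonicAt (fun w => fderiv ℝ (logLift U) w 1) ⟨Real.log r, θ⟩ :=
    harmonicAt_fderiv_one (harmonicAt_logLift hr₁ hU.contDiffOn hU.laplace
      (by simpa [Real.exp_log (hr₁.trans hr.1)] using hr))
  refine ⟨?_, ?_, ?_, ?_, ?_⟩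
  · refine ContDiffOn.congr
      (f := fun p : ℝ × ℝ => fderiv ℝ (logLift U) ⟨Real.log p.1, p.2⟩ 1) ?_
      fun p hp => mul_radialDeriv_eq hr₁ hU.contDiffOn hp.1 p.2
    rintro ⟨r, θ⟩ ⟨hr, -⟩
    have hlog : ContDiffAt ℝ 2 (fun p : ℝ × ℝ => (⟨Real.log p.1, p.2⟩ : ℂ)) (r, θ) := by
      have h₁ : ContDiffAt ℝ 2 (fun p : ℝ × ℝ => (Real.log p.1 : ℂ)) (r, θ) :=
        Complex.ofRealCLM.contDiff.contDiffAt.comp (r, θ)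
          (contDiffAt_fst.log (hr₁.trans hr.1).ne')
      have h₂ : ContDiffAt ℝ 2 (fun p : ℝ × ℝ => (p.2 : ℂ)) (r, θ) :=
        Complex.ofRealCLM.contDiff.contDiffAt.comp (r, θ) contDiffAt_snd
      simp only [Complex.mk_eq_add_mul_I]
      exact h₁.add (h₂.mul contDiffAt_const)
    exact ((hharm hr θ).1.comp (r, θ) hlog).contDiffWithinAt
  · exact continuousOn_fst.mul (continuousOn_radialDeriv hr₁₂ hU.contDiffOn_closed)
  · intro r hr θ
    simp only [radialDeriv]
    rw [derivWithin_congr (fun s hs => hU.periodic s hs θ) (hU.periodic r hr θ)]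
  · intro r hr θ
    rw [polarLaplacian_congr (fun s hs t => mul_radialDeriv_eq hr₁ hU.contDiffOn hs t) hr,
      polarLaplacian_comp_log (hr₁.trans hr.1) (hharm hr θ).1, (hharm hr θ).2.self_of_nhds]
    simp
  · intro r hr θ
    simp only [hU.boundary r hr θ]

/-! ### The integral representation -/

lemma IsNeumannSolution.hasDerivAt {r₁ r₂ r : ℝ} {φ U : ℝ → ℝ → ℝ}
    (hU : IsNeumannSolution r₁ r₂ φ U) (hr : r ∈ Ioo r₁ r₂) (θ : ℝ) :
    HasDerivAt (fun s => U s θ) (radialDeriv r₁ r₂ U r θ) r := by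
  rw [radialDeriv_eq_deriv U hr]
  exact ((contDiffAt_radial_slice hU.contDiffOn hr θ).differentiableAt two_ne_zero).hasDerivAt

/-- The radial derivative of `r U_r` equals `-(1/r) U_θθ`. -/
lemma IsNeumannSolution.deriv_mul_radialDeriv {r₁ r₂ r : ℝ} (hr₁ : 0 < r₁) {φ U : ℝ → ℝ → ℝ}
    (hU : IsNeumannSolution r₁ r₂ φ U) (hr : r ∈ Ioo r₁ r₂) (θ : ℝ) :
    deriv (fun s => s * radialDeriv r₁ r₂ U s θ) r = -(1 / r) * deriv (deriv (U r)) θ := by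
  have hr₀ : r ≠ 0 := (hr₁.trans hr.1).ne'
  have he : (fun s => s * radialDeriv r₁ r₂ U s θ)
      =ᶠ[𝓝 r] fun s => s * deriv (fun s => U s θ) s := by
    filter_upwards [isOpen_Ioo.mem_nhds hr] with s hs
    rw [radialDeriv_eq_deriv U hs]
  have hd : DifferentiableAt ℝ (deriv fun s => U s θ) r :=
    (((contDiffAt_radial_slice hU.contDiffOn hr θ).fderiv_right (m := 1)
      (by norm_num)).differentiableAt one_ne_zero).clm_apply (differentiableAt_const _)
  rw [he.deriv_eq, deriv_fun_mul differentiableAt_fun_id hd]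
  have hlap := hU.laplace r hr θ
  simp only [polarLaplacian] at hlap
  have : r * (deriv (deriv fun s => U s θ) r + 1 / r * deriv (fun s => U s θ) r
    + 1 / r ^ 2 * deriv (deriv (U r)) θ) = 0 := by rw [hlap, mul_zero]
  field_simp at this ⊢
  simp only [deriv_id'']
  linarith

lemma IsNeumannSolution.integral_radialDeriv {r₁ r₂ a r : ℝ} (hr₁₂ : r₁ < r₂)
    {φ U : ℝ → ℝ → ℝ} (hU : IsNeumannSolution r₁ r₂ φ U) (ha : a ∈ Icc r₁ r₂)
    (hr : r ∈ Icc r₁ r₂) (θ : ℝ) :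
    ∫ s in a..r, radialDeriv r₁ r₂ U s θ = U r θ - U a θ := by
  have hsub : uIcc a r ⊆ Icc r₁ r₂ := uIcc_subset_Icc ha hr
  have hmaps : MapsTo (fun s : ℝ => (s, θ)) (uIcc a r) (Icc r₁ r₂ ×ˢ (univ : Set ℝ)) :=
    fun s hs => ⟨hsub hs, mem_univ _⟩
  have hcts : ContinuousOn (fun s : ℝ => (s, θ)) (uIcc a r) := by fun_prop
  refine intervalIntegral.integral_eq_sub_of_hasDeriv_right
    (f := fun s => U s θ) (hU.contDiffOn_closed.continuousOn.comp hcts hmaps) (fun s hs => ?_) ?_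
  · refine (hU.hasDerivAt ⟨?_, ?_⟩ θ).hasDerivWithinAt
    · exact (le_min ha.1 hr.1).trans_lt hs.1
    · exact hs.2.trans_le (max_le ha.2 hr.2)
  · exact ((continuousOn_radialDeriv hr₁₂ hU.contDiffOn_closed).comp hcts hmaps).intervalIntegrable

lemma integral_comp_mul_div {f : ℝ → ℝ} {a r : ℝ} (hr : r ≠ 0) :
    ∫ ρ in (a / r)..1, f (r * ρ) / ρ = ∫ s in a..r, f s / s := by
  have h := intervalIntegral.mul_integral_comp_mul_left (a := a / r) (b := 1) (c := r)
    (f := fun s => f s / s)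
  rw [mul_div_cancel₀ a hr, mul_one, ← intervalIntegral.integral_const_mul] at h
  rw [← h]
  refine intervalIntegral.integral_congr fun ρ _ => ?_
  -- The Jacobian `r` cancels; at `ρ = 0` both sides vanish because division by zero gives zero.
  field_simp

/-- The double integral of the second derivative of a periodic function, normalized. -/
lemma integral_circle_eq {f g : ℝ → ℝ} {a : ℝ} (ha : a ≠ 0) (hf : ContDiff ℝ 2 f)
    (hper : f (2 * Real.pi) = f 0) (hg : ∀ τ, g τ = -(1 / a) * deriv (deriv f) τ) (θ : ℝ) :
    a * ∫ t in (0 : ℝ)..θ, (1 / (2 * Real.pi) *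
      (∫ t in (0 : ℝ)..(2 * Real.pi), ∫ τ in (0 : ℝ)..t, g τ) - ∫ τ in (0 : ℝ)..t, g τ)
      = f θ - f 0 := by
  have hf' : ContDiff ℝ 1 (deriv f) := ((contDiff_succ_iff_deriv (n := 1)).1 hf).2.2
  have hdiff : Differentiable ℝ f := hf.differentiable two_ne_zero
  have hin (t : ℝ) : ∫ τ in (0 : ℝ)..t, g τ = -(1 / a) * (deriv f t - deriv f 0) := by
    simp only [hg]
    rw [intervalIntegral.integral_const_mul, intervalIntegral.integral_deriv_eq_sub
      (fun x _ => (hf'.differentiable one_ne_zero) x)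
      ((hf'.continuous_deriv le_rfl).intervalIntegrable _ _)]
  have hint (c d : ℝ) : IntervalIntegrable (deriv f) volume c d :=
    hf'.continuous.intervalIntegrable _ _
  have hout (c d : ℝ) : ∫ t in c..d, deriv f t = f d - f c :=
    intervalIntegral.integral_deriv_eq_sub (fun x _ => hdiff x) (hint c d)
  simp only [hin]
  have hpi := Real.pi_ne_zero
  -- By periodicity `deriv f` has mean zero, so only the constant `deriv f 0` survives the
  -- averaging.
  have hC : 1 / (2 * Real.pi) * (∫ t in (0 : ℝ)..(2 * Real.pi),
      -(1 / a) * (deriv f t - deriv f 0)) = 1 / a * deriv f 0 := by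
    rw [intervalIntegral.integral_const_mul, intervalIntegral.integral_sub (hint _ _) (by simp),
      hout, hper]
    simp
    field_simp
  rw [hC]
  have hs (t : ℝ) : 1 / a * deriv f 0 - -(1 / a) * (deriv f t - deriv f 0)
      = 1 / a * deriv f t := by ring
  simp only [hs, intervalIntegral.integral_const_mul, hout]
  field_simp

/-- The integral representation of the solution of the Neumann problem vanishing at `(a, 0)`. -/
lemma IsNeumannSolution.eq_integral {r₁ r₂ a : ℝ} (hr₁ : 0 < r₁) (hr₁₂ : r₁ < r₂)
    {φ U u : ℝ → ℝ → ℝ} (hU : IsNeumannSolution r₁ r₂ φ U) (ha : a ∈ Ioo r₁ r₂) (hUa : U a 0 = 0)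
    (hu : ∀ r ∈ Icc r₁ r₂, ∀ θ, u r θ = r * radialDeriv r₁ r₂ U r θ)
    {r : ℝ} (hr : r ∈ Icc r₁ r₂) (θ : ℝ) :
    U r θ = (∫ ρ in (a / r)..1, u (r * ρ) θ / ρ)
      + a * ∫ t in (0 : ℝ)..θ, (circleConst a u - ∫ τ in (0 : ℝ)..t, deriv (fun s => u s τ) a) := by
  have ha' := Ioo_subset_Icc_self ha
  have h₁ : ∫ ρ in (a / r)..1, u (r * ρ) θ / ρ = U r θ - U a θ := by
    rw [integral_comp_mul_div (f := fun s => u s θ) (hr₁.trans_le hr.1).ne',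
      ← hU.integral_radialDeriv hr₁₂ ha' hr]
    refine intervalIntegral.integral_congr fun s hs => ?_
    have hs' := uIcc_subset_Icc ha' hr hs
    have hs₀ : s ≠ 0 := (hr₁.trans_le hs'.1).ne'
    simp only [hu s hs']
    field_simp
  have hder (τ : ℝ) : deriv (fun s => u s τ) a = -(1 / a) * deriv (deriv (U a)) τ := by
    rw [← hU.deriv_mul_radialDeriv hr₁ ha]
    refine EventuallyEq.deriv_eq ?_
    filter_upwards [Icc_mem_nhds ha.1 ha.2] with s hs using hu s hs τ
  have h₂ := integral_circle_eq (hr₁.trans ha.1).ne' (contDiff_angular_slice hU.contDiffOn ha)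
    (by simpa using hU.periodic a ha' 0) hder θ
  rw [circleConst, h₁, h₂, hUa]
  ring

lemma sqrt_mul_mem_Ioo {r₁ r₂ : ℝ} (hr₁ : 0 < r₁) (hr₁₂ : r₁ < r₂) :
    Real.sqrt (r₁ * r₂) ∈ Ioo r₁ r₂ := by
  constructor
  · rw [Real.lt_sqrt hr₁.le]
    nlinarith
  · rw [Real.sqrt_lt' (hr₁.trans hr₁₂)]
    nlinarith

end AnnulusPolar

theorem mainTheorem1 (r₁ r₂ : ℝ) (hr₁ : 0 < r₁) (hr₁₂ : r₁ < r₂) :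
    (∀ φ U : ℝ → ℝ → ℝ,
      AnnulusPolar.IsBoundaryData r₁ r₂ φ →
      (∫ θ in (0 : ℝ)..(2 * Real.pi), r₁ * φ r₁ θ)
        = (∫ θ in (0 : ℝ)..(2 * Real.pi), r₂ * φ r₂ θ) →
      AnnulusPolar.IsNeumannSolution r₁ r₂ φ U →
      U (Real.sqrt (r₁ * r₂)) 0 = 0 →
      (∃ u : ℝ → ℝ → ℝ, AnnulusPolar.IsDirichletSolution r₁ r₂ (fun r θ => r * φ r θ) u) ∧
      (∀ u v : ℝ → ℝ → ℝ,
        AnnulusPolar.IsDirichletSolution r₁ r₂ (fun r θ => r * φ r θ) u →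
        AnnulusPolar.IsDirichletSolution r₁ r₂ (fun r θ => r * φ r θ) v →
        ∀ r ∈ Set.Icc r₁ r₂, ∀ θ : ℝ, u r θ = v r θ) ∧
      (∀ u : ℝ → ℝ → ℝ,
        AnnulusPolar.IsDirichletSolution r₁ r₂ (fun r θ => r * φ r θ) u →
        ∀ r ∈ Set.Icc r₁ r₂, ∀ θ : ℝ,
          U r θ = (∫ ρ in (Real.sqrt (r₁ * r₂) / r)..1, u (r * ρ) θ / ρ)
            + Real.sqrt (r₁ * r₂) * ∫ t in (0 : ℝ)..θ,
                (AnnulusPolar.circleConst (Real.sqrt (r₁ * r₂)) u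
                  - ∫ τ in (0 : ℝ)..t, deriv (fun s => u s τ) (Real.sqrt (r₁ * r₂))))) ∧
    (∀ φ U : ℝ → ℝ → ℝ,
      AnnulusPolar.IsBoundaryData r₁ r₂ φ →
      (∫ θ in (0 : ℝ)..(2 * Real.pi), φ r₁ θ) = (∫ θ in (0 : ℝ)..(2 * Real.pi), φ r₂ θ) →
      AnnulusPolar.IsNeumannSolution r₁ r₂ (fun r θ => φ r θ / r) U →
      AnnulusPolar.IsDirichletSolution r₁ r₂ φ
        (fun r θ => r * AnnulusPolar.radialDeriv r₁ r₂ U r θ) ∧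
      (∀ v : ℝ → ℝ → ℝ, AnnulusPolar.IsDirichletSolution r₁ r₂ φ v →
        ∀ r ∈ Set.Icc r₁ r₂, ∀ θ : ℝ,
          v r θ = r * AnnulusPolar.radialDeriv r₁ r₂ U r θ)) := by
  refine ⟨fun φ U _ _ hU hU₀ => ?_, fun φ U _ _ hU => ?_⟩
  · have hD := hU.isDirichletSolution hr₁ hr₁₂
    exact ⟨⟨_, hD⟩, fun u v hu hv r hr θ => hu.unique hr₁ hv hr θ, fun u hu r hr θ =>
      hU.eq_integral hr₁ hr₁₂ (AnnulusPolar.sqrt_mul_mem_Ioo hr₁ hr₁₂) hU₀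
        (fun r hr θ => hu.unique hr₁ hD hr θ) hr θ⟩
  · have hD : AnnulusPolar.IsDirichletSolution r₁ r₂ φ
        (fun r θ => r * AnnulusPolar.radialDeriv r₁ r₂ U r θ) := by
      -- The data `r * (φ r θ / r)` and `φ r θ` need to agree only on the two boundary circles,
      -- where `r ≠ 0`.
      refine (hU.isDirichletSolution hr₁ hr₁₂).congr_data fun r hr θ => ?_
      have hr₀ : r ≠ 0 := by
        rcases hr with rfl | rfl
        · exact hr₁.ne'
        · exact (hr₁.trans hr₁₂).ne'
      exact mul_div_cancel₀ _ hr₀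
    exact ⟨hD, fun v hv r hr θ => hv.unique hr₁ hD hr θ⟩
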